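/- Let $\lambda = 2\cos(\pi/5)$, and let $H_5$ be the (homogeneous) Hecke group, i.e. the subgroup of $SL(2,\mathbb R)$ generated by $$S=\begin{pmatrix}0&1\\-1&0\end{pmatrix},\qquad T=\begin{pmatrix}1&\lambda\\0&1\end{pmatrix}.$$ For an ideal $A$ of $\mathbb Z[\lambda]$ let $$H(A)=\{(a_{ij})\in H_5 : a_{11}-1,\ a_{22}-1,\ a_{12},\ a_{21}\in A\},$$ write $H(\tau)=H((\tau))$ for $\tau\in\mathbb Z[\lambda]$, and let $N(A)=|\mathbb Z[\lambda]/A|$ (taken to be $0$ for $A=0$) and $N(\tau)=N((\tau))$ denote absolute norms. Let $\varpi\in\mathbb Z[\lambda]$ satisfy $\gcd(N(\varpi),6)=1$, and let $a,b\ge 0$ be integers. Then $H(2^a3^b\varpi)$ has finite index in $H_5$, and $$[H_5:H(2^a3^b\varpi)] = I_a\,J_b\,N(\varpi)^3\prod_{P\mid(\varpi)}\bigl(1-N(P)^{-2}\bigr),$$ where the product is over the set of all prime ideals $P$ of $\mathbb Z[\lambda]$ that divide $(\varpi)$, and $I_0=1$, $I_1=10$, $I_a=5\cdot 2^{6(a-1)}$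 for $a\ge 2$, and $J_0=1$, $J_b=120\cdot 3^{6(b-1)}$ for $b\ge 1$. -/

import Mathlib

namespace HeckeIndex

open scoped MatrixGroups

/-- The number `lam q = 2 cos (π / q)`. -/
noncomputable def lam (q : ℕ) : ℝ := 2 * Real.cos (Real.pi / q)

/-- The ring `ℤ[lam q]`, as a subring of the real numbers. -/
noncomputable abbrev ZLam (q : ℕ) : Subalgebra ℤ ℝ := Algebra.adjoin ℤ {lam q}

/-- The generator `S` of the Hecke group. -/
noncomputable def matS : SL(2, ℝ) :=
  ⟨!![0, 1; -1, 0], by simp [Matrix.det_fin_two]⟩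

/-- The generator `T` of the Hecke group `H_q`. -/
noncomputable def matT (q : ℕ) : SL(2, ℝ) :=
  ⟨!![1, lam q; 0, 1], by simp [Matrix.det_fin_two]⟩

/-- The (homogeneous) Hecke group `H_q`, the subgroup of `SL(2, ℝ)` generated by `S` and `T`. -/
noncomputable def hecke (q : ℕ) : Subgroup SL(2, ℝ) := Subgroup.closure {matS, matT q}

/-- `InIdeal A x` says that the real number `x` is an element of the ideal `A` of `ℤ[lam q]`. -/
def InIdeal {q : ℕ} (A : Ideal (ZLam q)) (x : ℝ) : Prop := ∃ y ∈ A, (y : ℝ) = x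

theorem InIdeal.add {q : ℕ} {A : Ideal (ZLam q)} {x y : ℝ} (hx : InIdeal A x)
    (hy : InIdeal A y) : InIdeal A (x + y) := by
  obtain ⟨u, hu, rfl⟩ := hx
  obtain ⟨v, hv, rfl⟩ := hy
  exact ⟨u + v, A.add_mem hu hv, by simp⟩

theorem InIdeal.neg {q : ℕ} {A : Ideal (ZLam q)} {x : ℝ} (hx : InIdeal A x) :
    InIdeal A (-x) := by
  obtain ⟨u, hu, rfl⟩ := hx
  exact ⟨-u, A.neg_mem hu, by simp⟩

theorem InIdeal.mul {q : ℕ} {A : Ideal (ZLam q)} {x y : ℝ} (hx : InIdeal A x)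
    (hy : InIdeal A y) : InIdeal A (x * y) := by
  obtain ⟨u, hu, rfl⟩ := hx
  obtain ⟨v, hv, rfl⟩ := hy
  exact ⟨u * v, A.mul_mem_left u hv, by simp⟩

theorem InIdeal.zero {q : ℕ} (A : Ideal (ZLam q)) : InIdeal A 0 :=
  ⟨0, A.zero_mem, by simp⟩

/-- The principal congruence subgroup `H(A)` of `H_q`, for an ideal `A` of `ℤ[lam q]`. -/
noncomputable def principalCongruence {q : ℕ} (A : Ideal (ZLam q)) : Subgroup SL(2, ℝ) where
  carrier := {g | g ∈ hecke q ∧ InIdeal A (g 0 0 - 1) ∧ InIdeal A (g 1 1 - 1) ∧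
    InIdeal A (g 0 1) ∧ InIdeal A (g 1 0)}
  one_mem' := by
    refine ⟨one_mem _, ?_, ?_, ?_, ?_⟩ <;> simpa using InIdeal.zero A
  mul_mem' := by
    rintro g h ⟨hg, g1, g2, g3, g4⟩ ⟨hh, h1, h2, h3, h4⟩
    refine ⟨mul_mem hg hh, ?_, ?_, ?_, ?_⟩
    · convert (((g1.mul h1).add g1).add h1).add (g3.mul h4) using 1
      simp [Matrix.mul_apply, Fin.sum_univ_two]
      ring
    · convert (((g2.mul h2).add g2).add h2).add (g4.mul h3) using 1
      simp [Matrix.mul_apply, Fin.sum_univ_two]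
      ring
    · convert (((g1.mul h3).add h3).add (g3.mul h2)).add g3 using 1
      simp [Matrix.mul_apply, Fin.sum_univ_two]
      ring
    · convert (((g4.mul h1).add g4).add (g2.mul h4)).add h4 using 1
      simp [Matrix.mul_apply, Fin.sum_univ_two]
      ring
  inv_mem' := by
    rintro g ⟨hg, g1, g2, g3, g4⟩
    refine ⟨inv_mem hg, ?_, ?_, ?_, ?_⟩
    · simpa [Matrix.SpecialLinearGroup.SL2_inv_expl] using g2
    · simpa [Matrix.SpecialLinearGroup.SL2_inv_expl] using g1
    · simpa [Matrix.SpecialLinearGroup.SL2_inv_expl] using g3.neg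
    · simpa [Matrix.SpecialLinearGroup.SL2_inv_expl] using g4.neg

/-- The absolute norm `N(A)` of an ideal: the number of elements of `ℤ[lam q] / A`
(`0` when this quotient is infinite, that is, for the zero ideal). -/
noncomputable def idealNorm {q : ℕ} (A : Ideal (ZLam q)) : ℕ := Nat.card (ZLam q ⧸ A)

/-- The absolute norm `N(x)` of an element, the norm of the ideal `(x)`. -/
noncomputable def elemNorm {q : ℕ} (x : ZLam q) : ℕ := idealNorm (Ideal.span {x})

/-- The set of prime ideals of `ℤ[lam q]` that divide the ideal `(x)`. -/
def primeDivisors {q : ℕ} (x : ZLam q) : Set (Ideal (ZLam q)) :=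
  {P | P.IsPrime ∧ P ∣ Ideal.span {x}}

/-- When `N(x)` is nonzero, `(x)` has finitely many prime divisors, so that finite products
over `primeDivisors x` have no default value. -/
theorem finite_primeDivisors {q : ℕ} (x : ZLam q) (hx : elemNorm x ≠ 0) :
    (primeDivisors x).Finite := by
  have hfin : Finite (ZLam q ⧸ Ideal.span {x}) := Nat.finite_of_card_ne_zero hx
  have hf : Finite (Set (ZLam q ⧸ Ideal.span {x})) := inferInstance
  refine Set.Finite.of_finite_image
    (f := fun P => ((fun y => Ideal.Quotient.mk (Ideal.span {x}) y) '' (P : Set (ZLam q))))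
    (Set.toFinite _) ?_
  have key : ∀ P ∈ primeDivisors x, ∀ Q ∈ primeDivisors x,
      (fun y => Ideal.Quotient.mk (Ideal.span {x}) y) '' (P : Set (ZLam q)) =
      (fun y => Ideal.Quotient.mk (Ideal.span {x}) y) '' (Q : Set (ZLam q)) → P ≤ Q := by
    intro P _ Q hQ h y hy
    have : Ideal.Quotient.mk (Ideal.span {x}) y ∈
        (fun y => Ideal.Quotient.mk (Ideal.span {x}) y) '' (Q : Set (ZLam q)) :=
      h ▸ ⟨y, hy, rfl⟩
    obtain ⟨z, hz, hzy⟩ := this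
    have h1 : z - y ∈ Q := Ideal.le_of_dvd hQ.2 (Ideal.Quotient.eq.mp hzy)
    have h2 := Q.sub_mem hz h1
    simpa using h2
  intro P hP Q hQ h
  exact le_antisymm (key P hP Q hQ h) (key Q hQ P hP h.symm)

/-- The factor `I_a` of the index formula. -/
def factorI : ℕ → ℕ
  | 0 => 1
  | 1 => 10
  | a + 2 => 5 * 2 ^ (6 * (a + 1))

/-- The factor `J_b` of the index formula. -/
def factorJ : ℕ → ℕ
  | 0 => 1
  | b + 1 => 120 * 3 ^ (6 * b)

end HeckeIndex

/-! Reduction modulo `A` turns the index of H(A) into the order of the image of the Hecke group in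
SL(2, ℤ[λ]/A), that is, of the group generated there by S and T (`relIndex_principalCongruence`).
Since S⁴ = (ST)⁵ = 1, the Hecke group is the normal closure of T. Hence the kernels at two ideals
containing coprime rational integers generate the whole group, and the order is multiplicative
(`card_levelImage_mul`). It remains to treat ϖ, 3^b and 2^a separately.

The question is then which translations `upper x` lie in the image. Those with x an integer multiple
of λ do. A word fixing the first basis line with eigenvalue u also yields x = u²λ, and λ² = λ + 1
makes this 48 or 8 modulo multiples of λ for suitable words (`fortyEight_mem_upperPart`,
`eight_mem_upperPart`).

Prime to 6, 48 is invertible, so all translations occur and the image is the full SL(2)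
(`levelImage_eq_top`). The order of that group comes from counting coprime columns
(`card_sl_two_eq_prod`). At 3^b, and at 2^a with a ≥ 2, the translations by 3 and by 4 occur, so the
image contains the whole kernel of reduction to level 3 or 4 (`mem_of_congruent_one`). The remaining
orders 10, 120, 320 at levels 2, 3, 4 come from a certified enumeration
(`card_heckeOver_of_codeCheck`). -/

namespace HeckeIndex

open scoped MatrixGroups

/-! ### Unipotent elements and the subgroup generated by S and T over a commutative ring -/

section General

variable {B : Type*} [CommRing B]

/-- The matrix `S` over an arbitrary commutative ring. -/
def weyl (B : Type*) [CommRing B] : SL(2, B) :=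
  ⟨!![0, 1; -1, 0], by simp [Matrix.det_fin_two]⟩

/-- The upper unipotent matrix with off-diagonal entry `x`. -/
def upper (x : B) : SL(2, B) := ⟨!![1, x; 0, 1], by simp [Matrix.det_fin_two]⟩

/-- The lower unipotent matrix with off-diagonal entry `x`. -/
def lower (x : B) : SL(2, B) := ⟨!![1, 0; x, 1], by simp [Matrix.det_fin_two]⟩

/-- The subgroup of `SL(2, B)` generated by `S` and the upper unipotent matrix of `l`. -/
def heckeOver (l : B) : Subgroup SL(2, B) := Subgroup.closure {weyl B, upper l}

theorem sl_ext {g h : SL(2, B)} (h1 : g 0 0 = h 0 0) (h2 : g 0 1 = h 0 1)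
    (h3 : g 1 0 = h 1 0) (h4 : g 1 1 = h 1 1) : g = h := by
  ext i j
  fin_cases i <;> fin_cases j <;> assumption

theorem sl_det (g : SL(2, B)) : g 0 0 * g 1 1 - g 0 1 * g 1 0 = 1 := by
  have := g.2
  rwa [Matrix.det_fin_two] at this

section Entries

variable (x : B) (g h : SL(2, B))

@[simp] theorem weyl_00 : weyl B 0 0 = 0 := rfl
@[simp] theorem weyl_01 : weyl B 0 1 = 1 := rfl
@[simp] theorem weyl_10 : weyl B 1 0 = -1 := rfl
@[simp] theorem weyl_11 : weyl B 1 1 = 0 := rfl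
@[simp] theorem upper_00 : upper x 0 0 = 1 := rfl
@[simp] theorem upper_01 : upper x 0 1 = x := rfl
@[simp] theorem upper_10 : upper x 1 0 = 0 := rfl
@[simp] theorem upper_11 : upper x 1 1 = 1 := rfl
@[simp] theorem lower_00 : lower x 0 0 = 1 := rfl
@[simp] theorem lower_01 : lower x 0 1 = 0 := rfl
@[simp] theorem lower_10 : lower x 1 0 = x := rfl
@[simp] theorem lower_11 : lower x 1 1 = 1 := rfl

theorem sl_mul_apply (i j : Fin 2) : (g * h) i j = g i 0 * h 0 j + g i 1 * h 1 j := by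
  simp [Matrix.mul_apply, Fin.sum_univ_two]

@[simp] theorem sl_inv_00 : g⁻¹ 0 0 = g 1 1 := by simp [Matrix.SpecialLinearGroup.SL2_inv_expl]
@[simp] theorem sl_inv_01 : g⁻¹ 0 1 = -g 0 1 := by simp [Matrix.SpecialLinearGroup.SL2_inv_expl]
@[simp] theorem sl_inv_10 : g⁻¹ 1 0 = -g 1 0 := by simp [Matrix.SpecialLinearGroup.SL2_inv_expl]
@[simp] theorem sl_inv_11 : g⁻¹ 1 1 = g 0 0 := by simp [Matrix.SpecialLinearGroup.SL2_inv_expl]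

end Entries

theorem upper_add (x y : B) : upper (x + y) = upper x * upper y := by
  apply sl_ext <;> simp [sl_mul_apply]
  ring

theorem upper_zero : upper (0 : B) = 1 := by
  apply sl_ext <;> simp

theorem upper_neg (x : B) : upper (-x) = (upper x)⁻¹ := by
  apply sl_ext <;> simp

theorem upper_injective : Function.Injective (upper : B → SL(2, B)) := fun x y h => by
  simpa using congrArg (fun g : SL(2, B) => g 0 1) h

theorem lower_eq (x : B) : lower x = weyl B * upper (-x) * (weyl B)⁻¹ := by
  apply sl_ext <;> simp [sl_mul_apply]

/-- The additive group of all `x` whose upper unipotent matrix lies in `H`. -/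
def upperPart (H : Subgroup SL(2, B)) : AddSubgroup B where
  carrier := {x | upper x ∈ H}
  zero_mem' := by simp [upper_zero, H.one_mem]
  add_mem' := fun {x y} hx hy => by
    simpa [upper_add] using H.mul_mem hx hy
  neg_mem' := fun {x} hx => by
    simpa [upper_neg] using H.inv_mem hx

theorem mem_upperPart {H : Subgroup SL(2, B)} {x : B} : x ∈ upperPart H ↔ upper x ∈ H := Iff.rfl

theorem lower_mem {H : Subgroup SL(2, B)} (hS : weyl B ∈ H) {x : B} (hx : x ∈ upperPart H) :
    lower x ∈ H := by
  rw [lower_eq]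
  exact H.mul_mem (H.mul_mem hS ((upperPart H).neg_mem hx)) (H.inv_mem hS)

theorem weyl_mem_heckeOver (l : B) : weyl B ∈ heckeOver l :=
  Subgroup.subset_closure (by simp)

theorem self_mem_upperPart (l : B) : l ∈ upperPart (heckeOver l) :=
  Subgroup.subset_closure (by simp)

theorem intCast_mul_mem_upperPart (l : B) (m : ℤ) : (m : B) * l ∈ upperPart (heckeOver l) := by
  rw [← zsmul_eq_mul]
  exact (upperPart _).zsmul_mem (self_mem_upperPart l) m

/-- An element fixing the line of the first basis vector rescales the upper unipotent
matrices by the square of its eigenvalue. -/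
theorem sq_mul_mem_upperPart {H : Subgroup SL(2, B)} {g : SL(2, B)} (hg : g ∈ H)
    (h0 : g 1 0 = 0) {t : B} (ht : t ∈ upperPart H) : g 0 0 ^ 2 * t ∈ upperPart H := by
  have : upper (g 0 0 ^ 2 * t) = g * upper t * g⁻¹ := by
    have hd := sl_det g
    apply sl_ext <;> simp [sl_mul_apply, h0] <;> grind
  rw [mem_upperPart, this]
  exact H.mul_mem (H.mul_mem hg ht) (H.inv_mem hg)

/-- The word below fixes the first basis line with eigenvalue 4l², the lower-left entry vanishing
because 4c = 1. It yields the translation by 16l⁵ = 80l + 48. -/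
theorem fortyEight_mem_upperPart {l : B} (hl : l ^ 2 = l + 1) {c : ℤ} (hc : 4 * (c : B) = 1) :
    (48 : B) ∈ upperPart (heckeOver l) := by
  have hu := intCast_mul_mem_upperPart l
  have hlow := fun m : ℤ => lower_mem (weyl_mem_heckeOver l) (hu m)
  have key := sq_mul_mem_upperPart
    (mul_mem (mul_mem (mul_mem (mul_mem (hlow c) (hu (-1))) (hlow (-1))) (hu 1)) (hlow 1)) (by
      simp [sl_mul_apply]
      grind) (self_mem_upperPart l)
  have := (upperPart _).sub_mem key (hu 80)
  convert this using 1
  simp [sl_mul_apply]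
  grind

/-- Same device: with 3c = 1 the word has eigenvalue l³, which yields the translation by l⁷ = 13l +
8. -/
theorem eight_mem_upperPart {l : B} (hl : l ^ 2 = l + 1) {c : ℤ} (hc : 3 * (c : B) = 1) :
    (8 : B) ∈ upperPart (heckeOver l) := by
  have hu := intCast_mul_mem_upperPart l
  have hlow := fun m : ℤ => lower_mem (weyl_mem_heckeOver l) (hu m)
  have key := sq_mul_mem_upperPart
    (mul_mem (mul_mem (mul_mem (mul_mem (hlow 3) (hu (-c))) (hlow 2)) (hu (-3))) (hlow 1)) (by
      simp [sl_mul_apply]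
      grind) (self_mem_upperPart l)
  have := (upperPart _).sub_mem key (hu 13)
  convert this using 1
  simp [sl_mul_apply]
  grind

/-- If `p` is nilpotent, a subgroup that contains `S`, the upper unipotent matrix of a unit
and all those with entry divisible by `p` contains the principal congruence subgroup of
level `p`. -/
theorem mem_of_congruent_one {H : Subgroup SL(2, B)} (hS : weyl B ∈ H) {l p : B}
    (hl : IsUnit l) (hlH : l ∈ upperPart H) (hp : IsNilpotent p)
    (hpH : ∀ x, p * x ∈ upperPart H) {g : SL(2, B)} (h00 : p ∣ g 0 0 - 1) (h01 : p ∣ g 0 1)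
    (h10 : p ∣ g 1 0) : g ∈ H := by
  obtain ⟨t, ht⟩ := h00
  obtain ⟨x, hx⟩ := h01
  obtain ⟨y, hy⟩ := h10
  obtain ⟨k, hk⟩ := hl.exists_right_inv
  have hun : IsUnit (g 0 0) := by
    have : g 0 0 = 1 + p * t := by linear_combination ht
    rw [this]
    exact (Commute.isNilpotent_mul_right (Commute.all p t) hp).isUnit_one_add
  obtain ⟨v, hv⟩ := hun.exists_right_inv
  -- As l * k = 1, the product `upper l * lower (p * (t * k))` has corner 1 + p * t = `g 0 0`. The
  -- outer factors correct the first column and the first row, and the determinant fixes the last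
  -- entry.
  have e : g = lower (p * ((y - t * k) * v)) * (upper l * lower (p * (t * k))) *
      (upper (p * (v * x + t * v * l)) * upper (-l)) := by
    have hd := sl_det g
    have hv' : v = 1 - p * t * v := by linear_combination hv - v * ht
    apply sl_ext
    · simp [sl_mul_apply]
      linear_combination ht - p * t * hk
    · simp [sl_mul_apply]
      grind
    · simp [sl_mul_apply]
      grind
    · apply hun.mul_left_cancel
      simp [sl_mul_apply]
      grind
  rw [e]
  exact H.mul_mem (H.mul_mem (lower_mem hS (hpH _)) (H.mul_mem hlH (lower_mem hS (hpH _))))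
    (H.mul_mem (hpH _) ((upperPart H).neg_mem hlH))

end General

/-! ### Generation and order of SL(2) over a finite ring -/

section FiniteRing

variable {B : Type*} [CommRing B]

theorem pairwise_isCoprime_maximal :
    Pairwise (Function.onFun IsCoprime fun m : MaximalSpectrum B => m.asIdeal) := by
  intro m n hmn
  exact Ideal.isCoprime_of_isMaximal (fun h => hmn (MaximalSpectrum.ext h))

theorem isUnit_iff_forall_maximal {x : B} :
    IsUnit x ↔ ∀ m : MaximalSpectrum B, x ∉ m.asIdeal := by
  constructor
  · exact fun hx m hm => m.isMaximal.ne_top (Ideal.eq_top_of_isUnit_mem _ hm hx)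
  · intro h
    by_contra hx
    obtain ⟨m, hm, hxm⟩ := exists_max_ideal_of_mem_nonunits hx
    exact h ⟨m, hm⟩ hxm

theorem isCoprime_iff_forall_maximal {x y : B} :
    IsCoprime x y ↔ ∀ m : MaximalSpectrum B, ¬ (x ∈ m.asIdeal ∧ y ∈ m.asIdeal) := by
  constructor
  · rintro ⟨a, b, h⟩ m ⟨hx, hy⟩
    exact m.isMaximal.ne_top ((Ideal.eq_top_iff_one _).2
      (h ▸ add_mem (m.asIdeal.mul_mem_left a hx) (m.asIdeal.mul_mem_left b hy)))
  · intro h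
    by_contra hc
    have hne : Ideal.span {x, y} ≠ ⊤ := fun ht => hc <| by
      obtain ⟨a, b, hab⟩ := Ideal.mem_span_pair.1 ((Ideal.eq_top_iff_one _).1 ht)
      exact ⟨a, b, hab⟩
    obtain ⟨m, hm, hle⟩ := Ideal.exists_le_maximal _ hne
    exact h ⟨m, hm⟩ ⟨hle (Ideal.subset_span (by simp)), hle (Ideal.subset_span (by simp))⟩

/-- Finite rings have stable range one. -/
theorem exists_isUnit_add_mul [Finite B] {x y : B} (h : IsCoprime x y) :
    ∃ t, IsUnit (x + t * y) := by
  classical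
  -- By the Chinese remainder theorem, t is 1 at the maximal ideals containing x and 0 at the
  -- others; x + t * y then avoids every maximal ideal.
  obtain ⟨t, ht⟩ := Ideal.exists_forall_sub_mem_ideal (pairwise_isCoprime_maximal (B := B))
    (fun m => if x ∈ m.asIdeal then 1 else 0)
  refine ⟨t, isUnit_iff_forall_maximal.2 fun m hm => ?_⟩
  have h1 := ht m
  by_cases hx : x ∈ m.asIdeal
  · rw [if_pos hx] at h1
    have h2 : y ∈ m.asIdeal := by
      have h3 := sub_mem (sub_mem hm hx) (m.asIdeal.mul_mem_right y h1)
      have e : x + t * y - x - (t - 1) * y = y := by ring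
      rwa [e] at h3
    exact isCoprime_iff_forall_maximal.1 h m ⟨hx, h2⟩
  · rw [if_neg hx, sub_zero] at h1
    exact hx (by simpa using sub_mem hm (m.asIdeal.mul_mem_right y h1))

theorem eq_top_of_upperPart_eq_top [Finite B] {H : Subgroup SL(2, B)} (hS : weyl B ∈ H)
    (hu : ∀ x, x ∈ upperPart H) : H = ⊤ := by
  have key : ∀ g : SL(2, B), IsUnit (g 0 0) → g ∈ H := by
    intro g hg
    obtain ⟨v, hv⟩ := hg.exists_right_inv
    have hd := sl_det g
    -- Gauss decomposition; the middle factor is the diagonal matrix with entries `g 0 0` and v.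
    have e : g = lower (g 1 0 * v) * (upper (g 0 0) * lower (-v) * upper (g 0 0) * (weyl B)⁻¹) *
        upper (v * g 0 1) := by
      apply sl_ext <;> simp [sl_mul_apply] <;> grind
    rw [e]
    exact mul_mem (mul_mem (lower_mem hS (hu _)) (mul_mem (mul_mem (mul_mem (hu _)
      (lower_mem hS (hu _))) (hu _)) (inv_mem hS))) (hu _)
  refine eq_top_iff.2 fun g _ => ?_
  have hd := sl_det g
  obtain ⟨t, ht⟩ := exists_isUnit_add_mul (x := g 0 0) (y := g 1 0)
    ⟨g 1 1, -g 0 1, by linear_combination hd⟩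
  have h1 : upper t * g ∈ H := key _ (by simpa [sl_mul_apply] using ht)
  exact (H.mul_mem_cancel_left (mem_upperPart.1 (hu t))).1 h1

/-- The elements of `SL(2, B)` are parametrized by their first column and a translation. -/
theorem card_sl_two : Nat.card SL(2, B) =
    Nat.card {v : B × B // IsCoprime v.1 v.2} * Nat.card B := by
  have hex : ∀ v : {v : B × B // IsCoprime v.1 v.2},
      ∃ g : SL(2, B), g 0 0 = v.1.1 ∧ g 1 0 = v.1.2 := by
    rintro ⟨⟨x, y⟩, a, b, hab⟩
    exact ⟨⟨!![x, -b; y, a], by simp [Matrix.det_fin_two]; linear_combination hab⟩, rfl, rfl⟩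
  choose σ h0 h1 using hex
  rw [← Nat.card_prod]
  symm
  refine Nat.card_congr (Equiv.ofBijective (fun p => σ p.1 * upper p.2) ⟨?_, ?_⟩)
  · rintro ⟨v, s⟩ ⟨w, t⟩ h
    have e0 := congrArg (fun g : SL(2, B) => g 0 0) h
    have e1 := congrArg (fun g : SL(2, B) => g 1 0) h
    simp only [sl_mul_apply, upper_00, upper_10, mul_one, mul_zero, add_zero, h0, h1] at e0 e1
    obtain rfl : v = w := Subtype.ext (Prod.ext e0 e1)
    exact Prod.ext rfl (upper_injective (mul_left_cancel h))
  · intro g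
    have hd := sl_det g
    let v : {v : B × B // IsCoprime v.1 v.2} :=
      ⟨(g 0 0, g 1 0), g 1 1, -g 0 1, by linear_combination hd⟩
    have a0 : σ v 0 0 = g 0 0 := h0 v
    have a1 : σ v 1 0 = g 1 0 := h1 v
    have ha := sl_det (σ v)
    refine ⟨(v, ((σ v)⁻¹ * g) 0 1), ?_⟩
    change σ v * upper _ = g
    rw [← eq_inv_mul_iff_mul_eq]
    symm
    apply sl_ext <;> simp [sl_mul_apply] <;> grind

theorem card_preimage_of_surjective {G H : Type*} [AddGroup G] [AddGroup H] (f : G →+ H)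
    (hf : Function.Surjective f) (s : Set H) :
    Nat.card {x // f x ∈ s} = Nat.card s * Nat.card f.ker := by
  choose σ hσ using hf
  rw [← Nat.card_prod]
  refine Nat.card_congr
    { toFun := fun x => (⟨f x, x.2⟩, ⟨x - σ (f x), by simp [AddMonoidHom.mem_ker, hσ]⟩)
      invFun := fun p => ⟨p.2 + σ p.1, by
        have : f p.2 = 0 := p.2.2
        simp [hσ, this]⟩
      left_inv := fun x => by simp
      right_inv := fun p => by
        have : f p.2 = 0 := p.2.2
        ext <;> simp [hσ, this] }

theorem card_eq_of_surjective {G H : Type*} [AddGroup G] [AddGroup H] (f : G →+ H)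
    (hf : Function.Surjective f) : Nat.card G = Nat.card H * Nat.card f.ker := by
  have := card_preimage_of_surjective f hf Set.univ
  rwa [Nat.card_congr (Equiv.subtypeUnivEquiv fun _ => Set.mem_univ _), Nat.card_univ] at this

theorem card_ne_zero_prod (F : Type*) [Zero F] [Finite F] :
    (Nat.card {v : F × F // v ≠ 0} : ℚ) = (Nat.card F : ℚ) ^ 2 - 1 := by
  classical
  have := Fintype.ofFinite F
  rw [Nat.card_eq_fintype_card, Fintype.card_subtype_compl, Fintype.card_subtype_eq,
    Fintype.card_prod, Nat.cast_sub]
  · simp [sq]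
  · exact Nat.mul_pos Fintype.card_pos Fintype.card_pos

/-- A pair is coprime exactly when it is nonzero over every residue field. Pairs map onto the
product of the residue planes with fibres of equal size, so the proportion of coprime pairs is the
product of the local proportions. -/
theorem card_coprime_pairs [Finite B] :
    (Nat.card {v : B × B // IsCoprime v.1 v.2} : ℚ) =
      (Nat.card B : ℚ) ^ 2 *
        ∏ᶠ m : MaximalSpectrum B, (1 - ((Nat.card (B ⧸ m.asIdeal) : ℚ) ^ 2)⁻¹) := by
  classical
  have := Fintype.ofFinite (MaximalSpectrum B)
  have hfin : ∀ m : MaximalSpectrum B, Finite (B ⧸ m.asIdeal) := fun m =>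
    Finite.of_surjective _ Ideal.Quotient.mk_surjective
  let f : B × B →+ ∀ m : MaximalSpectrum B, (B ⧸ m.asIdeal) × (B ⧸ m.asIdeal) :=
    { toFun := fun v m => (Ideal.Quotient.mk _ v.1, Ideal.Quotient.mk _ v.2)
      map_zero' := by ext <;> simp
      map_add' := fun x y => by ext <;> simp }
  have hf : Function.Surjective f := by
    intro w
    obtain ⟨x, hx⟩ := Ideal.pi_quotient_surjective (pairwise_isCoprime_maximal (B := B))
      fun m => (w m).1
    obtain ⟨y, hy⟩ := Ideal.pi_quotient_surjective (pairwise_isCoprime_maximal (B := B))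
      fun m => (w m).2
    exact ⟨(x, y), funext fun m => Prod.ext (hx m) (hy m)⟩
  have hset : ∀ v : B × B, IsCoprime v.1 v.2 ↔ f v ∈ Set.univ.pi fun _ => {0}ᶜ := by
    intro v
    simp [isCoprime_iff_forall_maximal, Set.mem_pi, f, Prod.ext_iff,
      Ideal.Quotient.eq_zero_iff_mem]
  have hcard : (Nat.card (Set.univ.pi fun m : MaximalSpectrum B =>
      ({0}ᶜ : Set ((B ⧸ m.asIdeal) × (B ⧸ m.asIdeal)))) : ℚ) =
      ∏ m : MaximalSpectrum B, ((Nat.card (B ⧸ m.asIdeal) : ℚ) ^ 2 - 1) := by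
    rw [Nat.card_congr (Equiv.Set.univPi _), Nat.card_pi, Nat.cast_prod]
    exact Finset.prod_congr rfl fun m _ => card_ne_zero_prod _
  have hB := card_eq_of_surjective f hf
  rw [Nat.card_congr (Equiv.subtypeEquivRight hset), card_preimage_of_surjective f hf,
    Nat.cast_mul, hcard, finprod_eq_prod_of_fintype]
  have hB' : (Nat.card B : ℚ) ^ 2 =
      (∏ m : MaximalSpectrum B, (Nat.card (B ⧸ m.asIdeal) : ℚ) ^ 2) * Nat.card f.ker := by
    rw [Nat.card_prod, Nat.card_pi] at hB
    rw [sq, ← Nat.cast_mul, hB]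
    push_cast
    simp [Nat.card_prod, sq]
  rw [hB', mul_right_comm, ← Finset.prod_mul_distrib]
  congr 1
  refine Finset.prod_congr rfl fun m _ => ?_
  have : (Nat.card (B ⧸ m.asIdeal) : ℚ) ≠ 0 := Nat.cast_ne_zero.2 Nat.card_pos.ne'
  field_simp

theorem card_sl_two_eq_prod [Finite B] :
    (Nat.card SL(2, B) : ℚ) = (Nat.card B : ℚ) ^ 3 *
      ∏ᶠ m : MaximalSpectrum B, (1 - ((Nat.card (B ⧸ m.asIdeal) : ℚ) ^ 2)⁻¹) := by
  rw [card_sl_two, Nat.cast_mul, card_coprime_pairs]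
  ring

theorem mem_ker_map_iff {B C : Type*} [CommRing B] [CommRing C] (f : B →+* C) {g : SL(2, B)} :
    g ∈ (Matrix.SpecialLinearGroup.map (n := Fin 2) f).ker ↔
      f (g 0 0) = 1 ∧ f (g 0 1) = 0 ∧ f (g 1 0) = 0 ∧ f (g 1 1) = 1 := by
  rw [MonoidHom.mem_ker]
  constructor
  · intro h
    have := fun i j => congrArg (fun g : SL(2, C) => g i j) h
    exact ⟨by simpa using this 0 0, by simpa using this 0 1, by simpa using this 1 0,
      by simpa using this 1 1⟩
  · rintro ⟨h1, h2, h3, h4⟩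
    apply sl_ext <;> simpa

/-- The kernel of reduction modulo a nil ideal is parametrized by three matrix entries. -/
theorem card_ker_map {C : Type*} [CommRing C] (f : B →+* C)
    (hf : ∀ x, f x = 0 → IsNilpotent x) :
    Nat.card (Matrix.SpecialLinearGroup.map (n := Fin 2) f).ker =
      Nat.card (RingHom.ker f) ^ 3 := by
  have hmem := fun g : SL(2, B) => mem_ker_map_iff f (g := g)
  have hunit : ∀ x, f x = 1 → IsUnit x := fun x hx => by
    have := (hf (x - 1) (by simp [hx])).isUnit_one_add
    rwa [add_sub_cancel] at this
  have e : Nat.card (RingHom.ker f) ^ 3 =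
      Nat.card (RingHom.ker f × RingHom.ker f × RingHom.ker f) := by
    simp only [Nat.card_prod]
    ring
  rw [e]
  refine Nat.card_congr (Equiv.ofBijective (fun g => (⟨g.1 0 0 - 1, ?_⟩, ⟨g.1 0 1, ?_⟩,
    ⟨g.1 1 0, ?_⟩)) ⟨?_, ?_⟩)
  · simp [RingHom.mem_ker, ((hmem g).1 g.2).1]
  · exact ((hmem g).1 g.2).2.1
  · exact ((hmem g).1 g.2).2.2.1
  · rintro ⟨g, hg⟩ ⟨h, hh⟩ e
    simp only [Prod.mk.injEq, Subtype.mk.injEq, sub_left_inj] at e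
    obtain ⟨e0, e1, e2⟩ := e
    replace e1 : g 0 1 = h 0 1 := congrArg Subtype.val e1
    replace e2 : g 1 0 = h 1 0 := congrArg Subtype.val e2
    refine Subtype.ext (sl_ext e0 e1 e2 ((hunit _ ((hmem g).1 hg).1).mul_left_cancel ?_))
    have hd := sl_det g
    have hd' := sl_det h
    change g 0 0 * g 1 1 = g 0 0 * h 1 1
    rw [e0, e1, e2] at hd
    rw [e0]
    linear_combination hd - hd'
  · rintro ⟨⟨x, hx⟩, ⟨y, hy⟩, ⟨z, hz⟩⟩
    rw [RingHom.mem_ker] at hx hy hz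
    obtain ⟨v, hv⟩ := (hunit (1 + x) (by simp [hx])).exists_right_inv
    refine ⟨⟨⟨!![1 + x, y; z, v * (1 + y * z)], ?_⟩, (hmem _).2 ⟨?_, hy, hz, ?_⟩⟩, ?_⟩
    · rw [Matrix.det_fin_two_of]
      linear_combination (1 + y * z) * hv
    · simp [hx]
    · have := congrArg f hv
      simp only [map_mul, map_add, map_one, hx] at this
      simpa [hy, hz] using this
    · simp

end FiniteRing

/-! ### ℤ[λ] is a principal ideal domain with basis 1, λ -/

section GoldenIntegers

theorem lam_five : lam 5 = Real.goldenRatio := by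
  rw [lam, Nat.cast_ofNat, Real.cos_pi_div_five, Real.goldenRatio]
  ring

/-- The generator `lam 5` of the ring `ℤ[lam 5]`. -/
noncomputable def gold : ZLam 5 := ⟨lam 5, Algebra.subset_adjoin rfl⟩

theorem gold_sq : gold ^ 2 = gold + 1 := by
  apply Subtype.ext
  simp [gold, lam_five, Real.goldenRatio_sq]

/-- The ring homomorphism from the abstract ring of golden integers. -/
noncomputable def quadHom : QuadraticAlgebra ℤ 1 1 →ₐ[ℤ] ZLam 5 :=
  QuadraticAlgebra.lift ⟨gold, by rw [← sq, gold_sq]; simp [add_comm]⟩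

theorem quadHom_apply (z : QuadraticAlgebra ℤ 1 1) : quadHom z = z.re + z.im * gold := by
  simp [quadHom, QuadraticAlgebra.lift]

theorem quadHom_injective : Function.Injective quadHom := by
  rw [injective_iff_map_eq_zero]
  intro z hz
  rw [quadHom_apply] at hz
  have h : (z.re : ℝ) + z.im * Real.goldenRatio = 0 := by
    simpa [gold, lam_five] using congrArg (fun x : ZLam 5 => (x : ℝ)) hz
  have him : z.im = 0 := by
    by_contra hne
    refine Real.goldenRatio_irrational ⟨-z.re / z.im, ?_⟩
    have : (z.im : ℝ) ≠ 0 := by exact_mod_cast hne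
    push_cast
    rw [div_eq_iff this]
    linarith
  have hre : z.re = 0 := by
    rw [him] at h
    simpa using h
  exact QuadraticAlgebra.ext hre him

theorem quadHom_surjective : Function.Surjective quadHom := by
  rintro ⟨x, hx⟩
  have hle : ZLam 5 ≤ quadHom.range.map (ZLam 5).val := by
    refine Algebra.adjoin_le ?_
    rintro _ rfl
    exact ⟨gold, ⟨⟨0, 1⟩, by change quadHom _ = _; simp [quadHom_apply]⟩, rfl⟩
  obtain ⟨_, ⟨z, rfl⟩, h⟩ := hle hx
  exact ⟨z, Subtype.ext h⟩

/-- `ℤ[lam 5]` as a quadratic algebra. -/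
noncomputable def quadEquiv : QuadraticAlgebra ℤ 1 1 ≃+* ZLam 5 :=
  RingEquiv.ofBijective quadHom ⟨quadHom_injective, quadHom_surjective⟩

theorem quadEquiv_apply (z : QuadraticAlgebra ℤ 1 1) : quadEquiv z = z.re + z.im * gold :=
  quadHom_apply z

theorem exists_int_add_mul_gold (x : ZLam 5) : ∃ a b : ℤ, x = a + b * gold := by
  obtain ⟨z, rfl⟩ := quadEquiv.surjective x
  exact ⟨z.re, z.im, quadEquiv_apply z⟩

theorem exists_two_mul_abs_sub_mul_le (a n : ℤ) (hn : n ≠ 0) : ∃ q, 2 * |a - q * n| ≤ |n| := by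
  refine ⟨round ((a : ℚ) / n), ?_⟩
  have h := abs_sub_round ((a : ℚ) / n)
  have hn' : (n : ℚ) ≠ 0 := by exact_mod_cast hn
  have e : ((a - round ((a : ℚ) / n) * n : ℤ) : ℚ) = ((a : ℚ) / n - round ((a : ℚ) / n)) * n := by
    push_cast
    field_simp
  have : (2 * |((a - round ((a : ℚ) / n) * n : ℤ) : ℚ)|) ≤ |(n : ℚ)| := by
    rw [e, abs_mul]
    nlinarith [abs_nonneg (n : ℚ)]
  exact_mod_cast this

/-- Rounding both coordinates of z / w leaves errors at most 1/2, and the norm form r² + rs − s² is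
then at most 3/4 in absolute value. -/
theorem exists_norm_sub_mul_lt (z w : QuadraticAlgebra ℤ 1 1) (hw : w.norm ≠ 0) :
    ∃ q, |(z - q * w).norm| < |w.norm| := by
  obtain ⟨q₁, h₁⟩ := exists_two_mul_abs_sub_mul_le (z * star w).re w.norm hw
  obtain ⟨q₂, h₂⟩ := exists_two_mul_abs_sub_mul_le (z * star w).im w.norm hw
  refine ⟨⟨q₁, q₂⟩, ?_⟩
  set r := (z * star w).re - q₁ * w.norm with hr
  set s := (z * star w).im - q₂ * w.norm with hs
  have e : (z - ⟨q₁, q₂⟩ * w) * star w = ⟨r, s⟩ := by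
    rw [sub_mul, mul_assoc, ← QuadraticAlgebra.algebraMap_norm_eq_mul_star]
    ext <;> simp [hr, hs]
  have e2 := congrArg QuadraticAlgebra.norm e
  rw [map_mul, QuadraticAlgebra.norm_star, QuadraticAlgebra.norm_def ⟨r, s⟩] at e2
  simp only [one_mul] at e2
  have hpos : 0 < |w.norm| := abs_pos.2 hw
  have e3 := congrArg abs e2
  rw [abs_mul] at e3
  have hb : |r * r + r * s - s * s| < |w.norm| * |w.norm| := by
    have h1 := abs_sub (r * r + r * s) (s * s)
    have h2 := abs_add_le (r * r) (r * s)
    simp only [abs_mul] at h1 h2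
    nlinarith [abs_nonneg r, abs_nonneg s,
      mul_nonneg (sub_nonneg.2 h₁) (add_nonneg hpos.le (abs_nonneg r)),
      mul_nonneg (sub_nonneg.2 h₂) (add_nonneg hpos.le (abs_nonneg s)),
      mul_nonneg (sub_nonneg.2 h₁) (abs_nonneg s), mul_nonneg (sub_nonneg.2 h₂) hpos.le,
      mul_nonneg (sub_nonneg.2 h₁) hpos.le]
  refine lt_of_mul_lt_mul_right ?_ hpos.le
  rwa [e3]

theorem isPrincipalIdealRing_quad : IsPrincipalIdealRing (QuadraticAlgebra ℤ 1 1) := by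
  have hdom : IsDomain (QuadraticAlgebra ℤ 1 1) := quadEquiv.injective.isDomain quadEquiv
  have hnorm : ∀ w : QuadraticAlgebra ℤ 1 1, w ≠ 0 → w.norm ≠ 0 := by
    intro w hw h
    have := QuadraticAlgebra.algebraMap_norm_eq_mul_star w
    rw [h, map_zero] at this
    rcases mul_eq_zero.1 this.symm with h | h
    · exact hw h
    · exact hw (star_eq_zero.1 h)
  refine ⟨fun I => ?_⟩
  by_cases hI : I = ⊥
  · rw [hI]
    exact ⟨0, by simp⟩
  · obtain ⟨x, hx, hx0⟩ := Submodule.exists_mem_ne_zero_of_ne_bot hI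
    have hne : {w | w ∈ I ∧ w ≠ 0}.Nonempty := ⟨x, hx, hx0⟩
    obtain ⟨w, ⟨hwI, hw0⟩, hmin⟩ := (measure fun w : QuadraticAlgebra ℤ 1 1 =>
      w.norm.natAbs).wf.has_min _ hne
    refine ⟨w, le_antisymm (fun z hz => ?_) (by simpa [Submodule.span_le] using hwI)⟩
    obtain ⟨q, hq⟩ := exists_norm_sub_mul_lt z w (hnorm w hw0)
    have hz' : z - q * w = 0 := by
      by_contra hne0
      refine hmin _ ⟨I.sub_mem hz (I.mul_mem_left q hwI), hne0⟩ ?_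
      change (z - q * w).norm.natAbs < w.norm.natAbs
      zify
      exact hq
    rw [sub_eq_zero.1 hz']
    exact Submodule.smul_mem _ q (Submodule.mem_span_singleton_self w)

instance : IsPrincipalIdealRing (ZLam 5) :=
  have := isPrincipalIdealRing_quad
  IsPrincipalIdealRing.of_surjective quadEquiv quadEquiv.surjective

end GoldenIntegers

/-! ### From the index to the image modulo A, and multiplicativity -/

section Level

/-- The image of the Hecke group in `SL(2, ℤ[lam 5] / A)`. -/
noncomputable abbrev levelImage (A : Ideal (ZLam 5)) : Subgroup SL(2, ZLam 5 ⧸ A) :=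
  heckeOver (Ideal.Quotient.mk A gold)

theorem map_heckeOver {B C : Type*} [CommRing B] [CommRing C] (f : B →+* C) (l : B) :
    (heckeOver l).map (Matrix.SpecialLinearGroup.map f) = heckeOver (f l) := by
  rw [heckeOver, heckeOver, MonoidHom.map_closure, Set.image_pair]
  congr
  · apply sl_ext <;> simp
  · apply sl_ext <;> simp

theorem mem_ker_quotient_iff {B : Type*} [CommRing B] (A : Ideal B) {g : SL(2, B)} :
    g ∈ (Matrix.SpecialLinearGroup.map (n := Fin 2) (Ideal.Quotient.mk A)).ker ↔
      g 0 0 - 1 ∈ A ∧ g 1 1 - 1 ∈ A ∧ g 0 1 ∈ A ∧ g 1 0 ∈ A := by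
  simp only [mem_ker_map_iff, ← Ideal.Quotient.eq_zero_iff_mem, map_sub, map_one, sub_eq_zero]
  tauto

/-- The inclusion of `SL(2, ℤ[lam 5])` in `SL(2, ℝ)`. -/
noncomputable def realEmbedding : SL(2, ZLam 5) →* SL(2, ℝ) :=
  Matrix.SpecialLinearGroup.map (algebraMap (ZLam 5) ℝ)

theorem realEmbedding_apply (g : SL(2, ZLam 5)) (i j : Fin 2) :
    realEmbedding g i j = (g i j : ℝ) := rfl

theorem realEmbedding_injective : Function.Injective realEmbedding := by
  intro g h e
  have := fun i j => congrArg (fun g : SL(2, ℝ) => g i j) e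
  exact sl_ext (Subtype.ext (this 0 0)) (Subtype.ext (this 0 1)) (Subtype.ext (this 1 0))
    (Subtype.ext (this 1 1))

theorem hecke_five : hecke 5 = (heckeOver gold).map realEmbedding := by
  rw [realEmbedding, map_heckeOver]
  rfl

theorem inIdeal_coe (A : Ideal (ZLam 5)) (x : ZLam 5) : InIdeal A (x : ℝ) ↔ x ∈ A :=
  ⟨fun ⟨_, hy, e⟩ => Subtype.ext e ▸ hy, fun hx => ⟨x, hx, rfl⟩⟩

theorem principalCongruence_five (A : Ideal (ZLam 5)) : principalCongruence A =
    (heckeOver gold ⊓ (Matrix.SpecialLinearGroup.map (Ideal.Quotient.mk A)).ker).map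
      realEmbedding := by
  have key : ∀ g : SL(2, ZLam 5), (InIdeal A (realEmbedding g 0 0 - 1) ∧
      InIdeal A (realEmbedding g 1 1 - 1) ∧ InIdeal A (realEmbedding g 0 1) ∧
      InIdeal A (realEmbedding g 1 0)) ↔
      g ∈ (Matrix.SpecialLinearGroup.map (n := Fin 2) (Ideal.Quotient.mk A)).ker := by
    intro g
    rw [mem_ker_quotient_iff, ← inIdeal_coe, ← inIdeal_coe, ← inIdeal_coe, ← inIdeal_coe]
    simp [realEmbedding_apply]
  ext g
  change g ∈ hecke 5 ∧ _ ↔ _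
  rw [hecke_five]
  constructor
  · rintro ⟨⟨g, hg, rfl⟩, h⟩
    exact ⟨g, ⟨hg, (key g).1 h⟩, rfl⟩
  · rintro ⟨g, ⟨hg, h⟩, rfl⟩
    exact ⟨⟨g, hg, rfl⟩, (key g).2 h⟩

theorem relIndex_principalCongruence (A : Ideal (ZLam 5)) :
    (principalCongruence A).relIndex (hecke 5) = Nat.card (levelImage A) := by
  rw [principalCongruence_five, hecke_five,
    Subgroup.relIndex_map_map_of_injective _ _ realEmbedding_injective,
    Subgroup.inf_relIndex_left, Subgroup.relIndex_ker, map_heckeOver]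

theorem weyl_pow_four {B : Type*} [CommRing B] : weyl B ^ 4 = 1 := by
  apply sl_ext <;> simp [pow_succ, sl_mul_apply]

theorem weyl_mul_upper_pow_five {B : Type*} [CommRing B] {l : B} (hl : l ^ 2 = l + 1) :
    (weyl B * upper l) ^ 5 = 1 := by
  apply sl_ext <;> simp [pow_succ, sl_mul_apply] <;> grind

/-- The group generated by `S` and the upper unipotent matrix `T` is the normal closure
of `T`. -/
theorem eq_top_of_upper_mem {B : Type*} [CommRing B] {l : B} (hl : l ^ 2 = l + 1)
    (N : Subgroup (heckeOver l)) [N.Normal]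
    (hN : (⟨upper l, self_mem_upperPart l⟩ : heckeOver l) ∈ N) : N = ⊤ := by
  set s : heckeOver l := ⟨weyl B, weyl_mem_heckeOver l⟩ with hs
  set t : heckeOver l := ⟨upper l, self_mem_upperPart l⟩ with ht
  have hsN : s ∈ N := by
    have h4 : s ^ 4 = 1 := Subtype.ext weyl_pow_four
    have h5 : (s * t) ^ 5 = 1 := Subtype.ext (weyl_mul_upper_pow_five hl)
    have h5' := congrArg (QuotientGroup.mk' N) h5
    have ht' : QuotientGroup.mk' N t = 1 := (QuotientGroup.eq_one_iff t).2 hN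
    -- Modulo N the relation (ST)⁵ = 1 becomes S⁵ = 1, and with S⁴ = 1 this gives S = 1.
    rw [map_pow, map_mul, ht', mul_one, ← map_pow, pow_succ, h4, one_mul, map_one] at h5'
    exact (QuotientGroup.eq_one_iff s).1 h5'
  have htop : (⊤ : Subgroup (heckeOver l)) =
      Subgroup.closure ((fun g : heckeOver l => g.1) ⁻¹' {weyl B, upper l}) :=
    (Subgroup.closure_closure_coe_preimage (k := {weyl B, upper l})).symm
  rw [eq_top_iff, htop, Subgroup.closure_le]
  rintro ⟨g, hg⟩ (h | h)
  · obtain rfl : g = weyl B := h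
    exact hsN
  · obtain rfl : g = upper l := h
    exact hN

/-- The kernel of reduction modulo `A` in the Hecke group. -/
noncomputable def levelKernel (A : Ideal (ZLam 5)) : Subgroup (heckeOver gold) :=
  ((Matrix.SpecialLinearGroup.map (Ideal.Quotient.mk A)).comp (heckeOver gold).subtype).ker

instance (A : Ideal (ZLam 5)) : (levelKernel A).Normal := by
  unfold levelKernel
  infer_instance

theorem mem_levelKernel {A : Ideal (ZLam 5)} {g : heckeOver gold} : g ∈ levelKernel A ↔
    g.1 0 0 - 1 ∈ A ∧ g.1 1 1 - 1 ∈ A ∧ g.1 0 1 ∈ A ∧ g.1 1 0 ∈ A :=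
  mem_ker_quotient_iff A

theorem index_levelKernel (A : Ideal (ZLam 5)) :
    (levelKernel A).index = Nat.card (levelImage A) := by
  rw [levelKernel, Subgroup.index_ker, MonoidHom.range_comp, Subgroup.range_subtype, map_heckeOver]

theorem upper_zpow {B : Type*} [CommRing B] (x : B) (m : ℤ) : upper x ^ m = upper (m * x) := by
  have h : ∀ n : ℕ, upper x ^ n = upper (n * x) := by
    intro n
    induction n with
    | zero => simp [upper_zero]
    | succ n ih => rw [pow_succ, ih, ← upper_add]; congr 1; push_cast; ring
  obtain ⟨n, rfl | rfl⟩ := m.eq_nat_or_neg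
  · simpa using h n
  · rw [zpow_neg, zpow_natCast, h, ← upper_neg]
    congr 1
    push_cast
    ring

theorem upper_zpow_mem_levelKernel {A : Ideal (ZLam 5)} {m : ℤ} (hm : (m : ZLam 5) ∈ A) :
    (⟨upper gold, self_mem_upperPart gold⟩ : heckeOver gold) ^ m ∈ levelKernel A := by
  rw [mem_levelKernel]
  simp [upper_zpow, A.mul_mem_right gold hm]

/-- T^m and T^n lie in the kernels at A and B, so T lies in their join, which is therefore
everything. The index of the intersection is then the product of the indices, even if the images are
not full. -/
theorem card_levelImage_mul {A B : Ideal (ZLam 5)} {m n : ℤ} (hm : (m : ZLam 5) ∈ A)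
    (hn : (n : ZLam 5) ∈ B) (hmn : IsCoprime m n) :
    Nat.card (levelImage (A * B)) = Nat.card (levelImage A) * Nat.card (levelImage B) := by
  obtain ⟨u, v, huv⟩ := hmn
  have hsup : levelKernel B ⊔ levelKernel A = ⊤ := by
    refine eq_top_of_upper_mem gold_sq _ ?_
    have := mul_mem
      (Subgroup.mem_sup_left ((levelKernel B).zpow_mem (upper_zpow_mem_levelKernel hn) v))
      (Subgroup.mem_sup_right ((levelKernel A).zpow_mem (upper_zpow_mem_levelKernel hm) u))
    rwa [← zpow_mul, ← zpow_mul, ← zpow_add,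
      show n * v + m * u = 1 by linear_combination huv, zpow_one] at this
  have hcop : IsCoprime A B := by
    rw [Ideal.isCoprime_iff_exists]
    refine ⟨u * m, A.mul_mem_left _ hm, v * n, B.mul_mem_left _ hn, ?_⟩
    exact_mod_cast congrArg (Int.cast : ℤ → ZLam 5) huv
  have hinf : levelKernel (A * B) = levelKernel A ⊓ levelKernel B := by
    ext g
    rw [Subgroup.mem_inf, mem_levelKernel, mem_levelKernel, mem_levelKernel,
      Ideal.mul_eq_inf_of_isCoprime hcop]
    simp only [Ideal.mem_inf]
    tauto
  rw [← index_levelKernel, ← index_levelKernel, ← index_levelKernel, hinf,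
    ← Subgroup.relIndex_top_right, ← Subgroup.relIndex_inf_mul_relIndex, inf_top_eq,
    ← Subgroup.relIndex_sup_right (levelKernel B) (levelKernel A), hsup,
    Subgroup.relIndex_top_right, Subgroup.relIndex_top_right]

end Level

/-! ### Certified enumeration of the group generated by S and T -/

section Enumeration

/-- A matrix with entries `i + j * l`, encoded by the pairs `(i, j)`. -/
abbrev Code := (ℕ × ℕ) × (ℕ × ℕ) × (ℕ × ℕ) × (ℕ × ℕ)

/-- Negation of an encoded entry modulo `n`. -/
def negMod (n : ℕ) (x : ℕ × ℕ) : ℕ × ℕ := ((n - 1) * x.1 % n, (n - 1) * x.2 % n)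

/-- The entry `x + l * y` modulo `n`, where `l ^ 2 = l + 1`. -/
def addGold (n : ℕ) (x y : ℕ × ℕ) : ℕ × ℕ := ((x.1 + y.2) % n, (x.2 + (y.1 + y.2)) % n)

/-- Left multiplication by `S` on codes. -/
def codeWeyl (n : ℕ) : Code → Code := fun (a, b, c, d) => (c, d, negMod n a, negMod n b)

/-- Left multiplication by `T` on codes. -/
def codeUpper (n : ℕ) : Code → Code := fun (a, b, c, d) => (addGold n a c, addGold n b d, c, d)

/-- The code of the identity matrix. -/
def codeOne : Code := ((1, 0), (0, 0), (0, 0), (1, 0))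

/-- Boolean equality of pairs. -/
def beqPair (x y : ℕ × ℕ) : Bool := Nat.beq x.1 y.1 && Nat.beq x.2 y.2

/-- Boolean equality of codes. -/
def beqCode (x y : Code) : Bool :=
  beqPair x.1 y.1 && (beqPair x.2.1 y.2.1 && (beqPair x.2.2.1 y.2.2.1 && beqPair x.2.2.2 y.2.2.2))

/-- Depth-first search for the orbit under `S` and `T`, with bounded fuel. -/
def codeSearch (n : ℕ) : ℕ → List Code → List Code → List Code
  | 0, _, v => v
  | _ + 1, [], v => v
  | k + 1, c :: s, v =>
    bif v.any (beqCode c) then codeSearch n k s v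
    else codeSearch n k (codeWeyl n c :: codeUpper n c :: s) (c :: v)

/-- The test that a list of codes is closed under `S` and `T`, contains the identity and has
length `N`. -/
def codeCheck (n N : ℕ) (v : List Code) : Bool :=
  (v.all fun c => v.any (beqCode (codeWeyl n c)) && v.any (beqCode (codeUpper n c))) &&
    (v.any (beqCode codeOne) && Nat.beq v.length N)

theorem beqPair_iff {x y : ℕ × ℕ} : beqPair x y = true ↔ x = y := by
  simp [beqPair, Prod.ext_iff]

theorem beqCode_iff {x y : Code} : beqCode x y = true ↔ x = y := by
  simp [beqCode, beqPair_iff, Prod.ext_iff]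

theorem any_beqCode_iff {x : Code} {v : List Code} : v.any (beqCode x) = true ↔ x ∈ v := by
  simp [List.any_eq_true, beqCode_iff]

/-- A predicate stable under `S` and `T` holds on the whole search list. -/
theorem codeSearch_induction {n : ℕ} {P : Code → Prop} (hw : ∀ c, P c → P (codeWeyl n c))
    (hu : ∀ c, P c → P (codeUpper n c)) (k : ℕ) (s v : List Code) (hs : ∀ c ∈ s, P c)
    (hv : ∀ c ∈ v, P c) : ∀ c ∈ codeSearch n k s v, P c := by
  induction k generalizing s v with
  | zero => exact hv
  | succ k ih =>
    cases s with
    | nil => exact hv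
    | cons c s =>
      have hc := hs c (by simp)
      have hs' : ∀ d ∈ s, P d := fun d hd => hs d (by simp [hd])
      rw [codeSearch]
      cases v.any (beqCode c)
      · refine ih _ _ ?_ ?_
        · simpa [hw c hc, hu c hc] using hs'
        · simpa [hc] using hv
      · exact ih _ _ hs' hv

theorem nodup_codeSearch (n k : ℕ) (s v : List Code) (hv : v.Nodup) :
    (codeSearch n k s v).Nodup := by
  induction k generalizing s v with
  | zero => exact hv
  | succ k ih =>
    cases s with
    | nil => exact hv
    | cons c s =>
      rw [codeSearch]
      cases h : v.any (beqCode c)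
      · refine ih _ _ (List.nodup_cons.2 ⟨fun hc => ?_, hv⟩)
        rw [any_beqCode_iff.2 hc] at h
        exact Bool.noConfusion h
      · exact ih _ _ hv

variable {B : Type*} [CommRing B]

/-- The ring element encoded by a pair. -/
def entry (l : B) (x : ℕ × ℕ) : B := x.1 + x.2 * l

/-- The code `c` encodes the matrix `g`. -/
def Encodes (l : B) (c : Code) (g : SL(2, B)) : Prop :=
  entry l c.1 = g 0 0 ∧ entry l c.2.1 = g 0 1 ∧ entry l c.2.2.1 = g 1 0 ∧ entry l c.2.2.2 = g 1 1

theorem natCast_mod_of_eq_zero {n : ℕ} (hn : (n : B) = 0) (m : ℕ) : ((m % n : ℕ) : B) = m := by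
  conv_rhs => rw [← Nat.mod_add_div m n]
  simp [hn]

theorem entry_negMod {l : B} {n : ℕ} (hn : (n : B) = 0) (h1 : 1 ≤ n) (x : ℕ × ℕ) :
    entry l (negMod n x) = -entry l x := by
  simp only [entry, negMod, natCast_mod_of_eq_zero hn, Nat.cast_mul, Nat.cast_sub h1, hn]
  push_cast
  ring

theorem entry_addGold {l : B} (hl : l ^ 2 = l + 1) {n : ℕ} (hn : (n : B) = 0) (x y : ℕ × ℕ) :
    entry l (addGold n x y) = entry l x + l * entry l y := by
  simp only [entry, addGold, natCast_mod_of_eq_zero hn, Nat.cast_add]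
  linear_combination -(y.2 : B) * hl

theorem encodes_codeWeyl {l : B} {n : ℕ} (hn : (n : B) = 0) (h1 : 1 ≤ n) {c : Code}
    {g : SL(2, B)} (h : Encodes l c g) : Encodes l (codeWeyl n c) (weyl B * g) := by
  obtain ⟨h00, h01, h10, h11⟩ := h
  refine ⟨?_, ?_, ?_, ?_⟩ <;> simp [codeWeyl, sl_mul_apply, entry_negMod hn h1, *]

theorem encodes_codeUpper {l : B} (hl : l ^ 2 = l + 1) {n : ℕ} (hn : (n : B) = 0) {c : Code}
    {g : SL(2, B)} (h : Encodes l c g) : Encodes l (codeUpper n c) (upper l * g) := by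
  obtain ⟨h00, h01, h10, h11⟩ := h
  refine ⟨?_, ?_, ?_, ?_⟩ <;> simp [codeUpper, sl_mul_apply, entry_addGold hl hn, *]

/-- The entries of a code are reduced modulo `n`. -/
def Reduced (n : ℕ) (c : Code) : Prop :=
  (c.1.1 < n ∧ c.1.2 < n) ∧ (c.2.1.1 < n ∧ c.2.1.2 < n) ∧ (c.2.2.1.1 < n ∧ c.2.2.1.2 < n) ∧
    (c.2.2.2.1 < n ∧ c.2.2.2.2 < n)

theorem reduced_codeWeyl {n : ℕ} (h1 : 1 < n) {c : Code} (h : Reduced n c) :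
    Reduced n (codeWeyl n c) := by
  have := fun m => Nat.mod_lt m (show 0 < n by omega)
  exact ⟨h.2.2.1, h.2.2.2, ⟨this _, this _⟩, this _, this _⟩

theorem reduced_codeUpper {n : ℕ} (h1 : 1 < n) {c : Code} (h : Reduced n c) :
    Reduced n (codeUpper n c) := by
  have := fun m => Nat.mod_lt m (show 0 < n by omega)
  exact ⟨⟨this _, this _⟩, ⟨this _, this _⟩, h.2.2.1, h.2.2.2⟩

/-- The order of the group generated by `S` and `T`, certified by a search. -/
theorem card_heckeOver_of_codeCheck {l : B} (hl : l ^ 2 = l + 1) {n : ℕ} (h1 : 1 < n)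
    (hn : (n : B) = 0)
    (hinj : ∀ x y : ℕ × ℕ, x.1 < n → x.2 < n → y.1 < n → y.2 < n → entry l x = entry l y → x = y)
    {N k : ℕ} (hcheck : codeCheck n N (codeSearch n k [codeOne] []) = true) :
    Nat.card (heckeOver l) = N := by
  classical
  obtain ⟨v, hv⟩ : ∃ v, v = codeSearch n k [codeOne] [] := ⟨_, rfl⟩
  have hnodup : v.Nodup := hv ▸ nodup_codeSearch n k _ _ List.nodup_nil
  have honeEnc : Encodes l codeOne 1 := by simp [Encodes, codeOne, entry]
  have hmem : ∀ c ∈ v, (∃ g ∈ heckeOver l, Encodes l c g) ∧ Reduced n c := by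
    rw [hv]
    refine codeSearch_induction ?_ ?_ _ _ _ ?_ ?_
    · rintro c ⟨⟨g, hg, h⟩, hr⟩
      exact ⟨⟨_, mul_mem (weyl_mem_heckeOver l) hg, encodes_codeWeyl hn h1.le h⟩,
        reduced_codeWeyl h1 hr⟩
    · rintro c ⟨⟨g, hg, h⟩, hr⟩
      exact ⟨⟨_, mul_mem (self_mem_upperPart l) hg, encodes_codeUpper hl hn h⟩,
        reduced_codeUpper h1 hr⟩
    · simp only [List.mem_singleton, forall_eq]
      exact ⟨⟨1, one_mem _, honeEnc⟩, by simp [Reduced, codeOne]; omega⟩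
    · simp
  rw [← hv] at hcheck
  simp only [codeCheck, Bool.and_eq_true, List.all_eq_true, any_beqCode_iff, Nat.beq_eq] at hcheck
  obtain ⟨hclosed, hone, hlen⟩ := hcheck
  have hweyl : ∀ g, (∃ c ∈ v, Encodes l c g) → ∃ c ∈ v, Encodes l c (weyl B * g) :=
    fun g ⟨c, hc, h⟩ => ⟨_, (hclosed c hc).1, encodes_codeWeyl hn h1.le h⟩
  have hupper : ∀ g, (∃ c ∈ v, Encodes l c g) → ∃ c ∈ v, Encodes l c (upper l * g) :=
    fun g ⟨c, hc, h⟩ => ⟨_, (hclosed c hc).2, encodes_codeUpper hl hn h⟩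
  have hpow : ∀ (s : SL(2, B)), (∀ g, (∃ c ∈ v, Encodes l c g) → ∃ c ∈ v, Encodes l c (s * g)) →
      ∀ (m : ℕ) g, (∃ c ∈ v, Encodes l c g) → ∃ c ∈ v, Encodes l c (s ^ m * g) := by
    intro s hs m g hg
    induction m with
    | zero => simpa using hg
    | succ m ih => rw [pow_succ', mul_assoc]; exact hs _ ih
  -- Both generators have finite order, so closure under left multiplication by them already gives
  -- closure under their inverses.
  have hwinv : (weyl B)⁻¹ = weyl B ^ 3 := by
    rw [inv_eq_iff_mul_eq_one, ← pow_succ']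
    exact weyl_pow_four
  have huinv : (upper l)⁻¹ = upper l ^ (n - 1) := by
    rw [inv_eq_iff_mul_eq_one, ← pow_succ', Nat.sub_add_cancel h1.le, ← zpow_natCast, upper_zpow]
    simp [hn, upper_zero]
  have hall : ∀ g ∈ heckeOver l, ∃ c ∈ v, Encodes l c g := by
    intro g hg
    induction hg using Subgroup.closure_induction_left with
    | one => exact ⟨codeOne, hone, honeEnc⟩
    | mul_left x hx y hy ih =>
      rcases hx with rfl | rfl
      · exact hweyl _ ih
      · exact hupper _ ih
    | inv_mul_cancel x hx y hy ih =>
      rcases hx with rfl | rfl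
      · rw [hwinv]
        exact hpow _ hweyl _ _ ih
      · rw [huinv]
        exact hpow _ hupper _ _ ih
  -- Each listed code comes from a group element and each group element has a listed code; reduced
  -- codes are unique, so the list length is the order.
  choose! f hf hfe using fun c hc => (hmem c hc).1
  have hbij : Function.Bijective
      (fun c : {c // c ∈ v.toFinset} => (⟨f c, hf c (List.mem_toFinset.1 c.2)⟩ : heckeOver l)) := by
    constructor
    · rintro ⟨c, hc⟩ ⟨d, hd⟩ h
      rw [List.mem_toFinset] at hc hd
      have e : f c = f d := congrArg Subtype.val h
      obtain ⟨a1, a2, a3, a4⟩ := hfe c hc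
      obtain ⟨b1, b2, b3, b4⟩ := hfe d hd
      rw [← e] at b1 b2 b3 b4
      obtain ⟨⟨p1, p2⟩, ⟨p3, p4⟩, ⟨p5, p6⟩, ⟨p7, p8⟩⟩ := (hmem c hc).2
      obtain ⟨⟨q1, q2⟩, ⟨q3, q4⟩, ⟨q5, q6⟩, ⟨q7, q8⟩⟩ := (hmem d hd).2
      exact Subtype.ext (Prod.ext (hinj _ _ p1 p2 q1 q2 (a1.trans b1.symm))
        (Prod.ext (hinj _ _ p3 p4 q3 q4 (a2.trans b2.symm))
          (Prod.ext (hinj _ _ p5 p6 q5 q6 (a3.trans b3.symm))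
            (hinj _ _ p7 p8 q7 q8 (a4.trans b4.symm)))))
    · rintro ⟨g, hg⟩
      obtain ⟨c, hc, a1, a2, a3, a4⟩ := hall g hg
      obtain ⟨b1, b2, b3, b4⟩ := hfe c hc
      exact ⟨⟨c, List.mem_toFinset.2 hc⟩, Subtype.ext (sl_ext (b1.symm.trans a1)
        (b2.symm.trans a2) (b3.symm.trans a3) (b4.symm.trans a4))⟩
  rw [← Nat.card_eq_of_bijective _ hbij, Nat.card_eq_fintype_card, Fintype.card_coe,
    List.toFinset_card_of_nodup hnodup, hlen]

/-- The fuel is 2N + 1: the starting code and two successors for each of the N recorded codes. -/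
theorem codeCheck_two : codeCheck 2 10 (codeSearch 2 21 [codeOne] []) = true := by
  decide +kernel

set_option maxRecDepth 10000 in
theorem codeCheck_three : codeCheck 3 120 (codeSearch 3 241 [codeOne] []) = true := by
  decide +kernel

set_option maxRecDepth 10000 in
theorem codeCheck_four : codeCheck 4 320 (codeSearch 4 641 [codeOne] []) = true := by
  decide +kernel

end Enumeration

/-! ### The quotients ℤ[λ]/(n) for rational integers n -/

section SmallLevels

theorem int_add_mul_gold_mem_span {n a b : ℤ} :
    (a + b * gold : ZLam 5) ∈ Ideal.span {(n : ZLam 5)} ↔ n ∣ a ∧ n ∣ b := by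
  rw [Ideal.mem_span_singleton]
  constructor
  · rintro ⟨z, hz⟩
    obtain ⟨c, d, rfl⟩ := exists_int_add_mul_gold z
    have h : quadEquiv ⟨a, b⟩ = quadEquiv ⟨n * c, n * d⟩ := by
      simp only [quadEquiv_apply, hz]
      push_cast
      ring
    have h' := quadEquiv.injective h
    rw [QuadraticAlgebra.mk.injEq] at h'
    exact ⟨⟨c, h'.1⟩, ⟨d, h'.2⟩⟩
  · rintro ⟨⟨c, rfl⟩, ⟨d, rfl⟩⟩
    exact ⟨c + d * gold, by push_cast; ring⟩

theorem mk_gold_sq (A : Ideal (ZLam 5)) :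
    Ideal.Quotient.mk A gold ^ 2 = Ideal.Quotient.mk A gold + 1 := by
  rw [← map_pow, gold_sq, map_add, map_one]

theorem exists_int_add_mul_mk_gold {A : Ideal (ZLam 5)} (x : ZLam 5 ⧸ A) :
    ∃ a b : ℤ, x = a + b * Ideal.Quotient.mk A gold := by
  obtain ⟨x, rfl⟩ := Ideal.Quotient.mk_surjective x
  obtain ⟨a, b, rfl⟩ := exists_int_add_mul_gold x
  exact ⟨a, b, by simp⟩

theorem natCast_quotient_span (n : ℕ) : (n : ZLam 5 ⧸ Ideal.span {(n : ZLam 5)}) = 0 := by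
  have : Ideal.Quotient.mk (Ideal.span {(n : ZLam 5)}) n = 0 :=
    Ideal.Quotient.eq_zero_iff_mem.2 (Ideal.mem_span_singleton_self _)
  simpa using this

theorem entry_mk_gold_injective (n : ℕ) (x y : ℕ × ℕ) (h1 : x.1 < n) (h2 : x.2 < n)
    (h3 : y.1 < n) (h4 : y.2 < n)
    (h : entry (Ideal.Quotient.mk (Ideal.span {(n : ZLam 5)}) gold) x =
      entry (Ideal.Quotient.mk (Ideal.span {(n : ZLam 5)}) gold) y) : x = y := by
  have h' : (((x.1 - y.1 : ℤ) : ZLam 5) + ((x.2 - y.2 : ℤ) : ZLam 5) * gold) ∈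
      Ideal.span {((n : ℤ) : ZLam 5)} := by
    rw [Int.cast_natCast, ← Ideal.Quotient.eq_zero_iff_mem]
    simp only [entry] at h
    simp only [map_add, map_mul, map_intCast]
    push_cast
    linear_combination h
  rw [int_add_mul_gold_mem_span] at h'
  have aux : ∀ i j : ℕ, i < n → j < n → (n : ℤ) ∣ i - j → i = j := fun i j hi hj hd => by
    have := Int.eq_zero_of_abs_lt_dvd hd (by rw [abs_lt]; omega)
    omega
  exact Prod.ext (aux _ _ h1 h3 h'.1) (aux _ _ h2 h4 h'.2)

theorem card_levelImage_of_codeCheck {n N k : ℕ} (h1 : 1 < n)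
    (h : codeCheck n N (codeSearch n k [codeOne] []) = true) :
    Nat.card (levelImage (Ideal.span {(n : ZLam 5)})) = N :=
  card_heckeOver_of_codeCheck (mk_gold_sq _) h1 (natCast_quotient_span n)
    (entry_mk_gold_injective n) h

/-- The absolute norm of a rational integer is its square. -/
theorem card_quotient_span_natCast {n : ℕ} (hn : 0 < n) :
    Nat.card (ZLam 5 ⧸ Ideal.span {(n : ZLam 5)}) = n ^ 2 := by
  have : NeZero n := ⟨hn.ne'⟩
  have hbij : Function.Bijective (fun x : Fin n × Fin n =>
      entry (Ideal.Quotient.mk (Ideal.span {(n : ZLam 5)}) gold) (x.1, x.2)) := by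
    constructor
    · intro x y h
      have := entry_mk_gold_injective n _ _ x.1.2 x.2.2 y.1.2 y.2.2 h
      rw [Prod.mk.injEq] at this
      exact Prod.ext (Fin.ext this.1) (Fin.ext this.2)
    · intro x
      obtain ⟨a, b, rfl⟩ := exists_int_add_mul_mk_gold x
      have key : ∀ a : ℤ, ∃ i : Fin n, ((i : ℕ) : ZLam 5 ⧸ Ideal.span {(n : ZLam 5)}) = a := by
        intro a
        have hpos : (0 : ℤ) < n := by exact_mod_cast hn
        obtain ⟨i, hi⟩ := Int.eq_ofNat_of_zero_le (Int.emod_nonneg a hpos.ne')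
        have hlt := Int.emod_lt_of_pos a hpos
        refine ⟨⟨i, by omega⟩, ?_⟩
        have e : a = n * (a / n) + i := by rw [← hi]; exact (Int.mul_ediv_add_emod a n).symm
        have e' := congrArg (Int.cast : ℤ → ZLam 5 ⧸ Ideal.span {(n : ZLam 5)}) e
        push_cast at e'
        rw [natCast_quotient_span n, zero_mul, zero_add] at e'
        exact e'.symm
      obtain ⟨i, hi⟩ := key a
      obtain ⟨j, hj⟩ := key b
      exact ⟨(i, j), by simp [entry, hi, hj]⟩
  rw [← Nat.card_eq_of_bijective _ hbij, Nat.card_prod, Nat.card_fin, sq]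

end SmallLevels

/-! ### Lifting along powers of 2 and 3 -/

section Lifting

/-- If `p` is nilpotent and the translation by `p` lies in the group generated by `S` and `T`,
then so does the whole congruence subgroup of level `p`. -/
theorem mem_heckeOver_of_congruent_one {B : Type*} [CommRing B] {l : B} (hl : l ^ 2 = l + 1)
    (hspan : ∀ x : B, ∃ a b : ℤ, x = a + b * l) {p : ℤ} (hp : IsNilpotent (p : B))
    (hpl : (p : B) ∈ upperPart (heckeOver l)) {g : SL(2, B)} (h00 : (p : B) ∣ g 0 0 - 1)
    (h01 : (p : B) ∣ g 0 1) (h10 : (p : B) ∣ g 1 0) : g ∈ heckeOver l := by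
  refine mem_of_congruent_one (weyl_mem_heckeOver l)
    (IsUnit.of_mul_eq_one (l - 1) (by linear_combination hl)) (self_mem_upperPart l) hp
    (fun x => ?_) h00 h01 h10
  obtain ⟨a, b, rfl⟩ := hspan x
  -- p * (a + b * l) splits into a copies of p and an integer multiple of l, which is always
  -- available.
  have h := add_mem ((upperPart (heckeOver l)).zsmul_mem hpl a)
    (intCast_mul_mem_upperPart l (p * b))
  rw [zsmul_eq_mul] at h
  convert h using 1
  push_cast
  ring

/-- If `2` is nilpotent, the translation by `4` lies in the group generated by `S` and `T`. -/
theorem four_mem_upperPart {B : Type*} [CommRing B] {l : B} (hl : l ^ 2 = l + 1)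
    (hspan : ∀ x : B, ∃ a b : ℤ, x = a + b * l) (h2 : IsNilpotent (2 : B)) {c : ℤ}
    (hc : 3 * (c : B) = 1) : (4 : B) ∈ upperPart (heckeOver l) := by
  have hu := intCast_mul_mem_upperPart l
  have hlow := fun m : ℤ => lower_mem (weyl_mem_heckeOver l) (hu m)
  -- This word is congruent to `upper 4` modulo 8, and the level 8 congruence subgroup is already in
  -- the group by `eight_mem_upperPart`. The witnesses below are the entries of `w * upper (-4) - 1`
  -- divided by 8.
  have hw := mul_mem (mul_mem (mul_mem (mul_mem (mul_mem (mem_upperPart.1 (hu 6)) (hlow (-2)))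
    (mem_upperPart.1 (hu 1))) (hlow (-4))) (mem_upperPart.1 (hu 1))) (hlow (-2))
  set w := upper (((6 : ℤ) : B) * l) * lower (((-2 : ℤ) : B) * l) * upper (((1 : ℤ) : B) * l) *
    lower (((-4 : ℤ) : B) * l) * upper (((1 : ℤ) : B) * l) * lower (((-2 : ℤ) : B) * l) with hw'
  have h8 : IsNilpotent ((8 : ℤ) : B) := by
    have : ((8 : ℤ) : B) = 2 ^ 3 := by norm_num
    rw [this]
    exact h2.pow_of_pos (by norm_num)
  have h : w * upper (-4) ∈ heckeOver l := by
    refine mem_heckeOver_of_congruent_one hl hspan h8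
      (by exact_mod_cast eight_mem_upperPart hl hc) ?_ ?_ ?_
    · refine ⟨-29 - 46 * l, ?_⟩
      simp [hw', sl_mul_apply]
      grind
    · refine ⟨127 + 202 * l, ?_⟩
      simp [hw', sl_mul_apply]
      grind
    · refine ⟨-3 - 5 * l, ?_⟩
      simp [hw', sl_mul_apply]
      grind
  rw [upper_neg] at h
  exact (mem_upperPart).2 (by simpa using (Subgroup.mul_mem_cancel_left _ hw).1 h)

theorem card_eq_card_mul_card_ringHom_ker {B C : Type*} [CommRing B] [CommRing C] (f : B →+* C)
    (hf : Function.Surjective f) : Nat.card B = Nat.card C * Nat.card (RingHom.ker f) :=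
  card_eq_of_surjective f.toAddMonoidHom hf

theorem card_heckeOver_eq_mul {B C : Type*} [CommRing B] [CommRing C] (f : B →+* C) (l : B)
    (hnil : ∀ x, f x = 0 → IsNilpotent x)
    (hker : (Matrix.SpecialLinearGroup.map (n := Fin 2) f).ker ≤ heckeOver l) :
    Nat.card (heckeOver l) = Nat.card (heckeOver (f l)) * Nat.card (RingHom.ker f) ^ 3 := by
  have h := Subgroup.relIndex_mul_relIndex ⊥ (Matrix.SpecialLinearGroup.map (n := Fin 2) f).ker
    (heckeOver l) bot_le hker
  rw [Subgroup.relIndex_bot_left, Subgroup.relIndex_bot_left, Subgroup.relIndex_ker,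
    map_heckeOver, card_ker_map f hnil] at h
  rw [← h, mul_comm]

/-- The ideal generated by p modulo p * q has q² elements and is nil, so the reduction kernel in
SL(2) has q⁶ elements; the translation by p puts all of it in the image. -/
theorem card_levelImage_mul_of_nilpotent {p q : ℕ} (hp : 0 < p) (hq : 0 < q)
    (hnil : ∃ e, p * q ∣ p ^ e)
    (h : (p : ZLam 5 ⧸ Ideal.span {((p * q : ℕ) : ZLam 5)}) ∈
      upperPart (levelImage (Ideal.span {((p * q : ℕ) : ZLam 5)}))) :
    Nat.card (levelImage (Ideal.span {((p * q : ℕ) : ZLam 5)})) =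
      Nat.card (levelImage (Ideal.span {(p : ZLam 5)})) * q ^ 6 := by
  have hle : Ideal.span {((p * q : ℕ) : ZLam 5)} ≤ Ideal.span {(p : ZLam 5)} := by
    rw [Ideal.span_singleton_le_span_singleton]
    exact ⟨q, by push_cast; ring⟩
  have hA0 := natCast_quotient_span (p * q)
  have hAc := card_quotient_span_natCast (Nat.mul_pos hp hq)
  have hpow : ∃ e, (p : ZLam 5 ⧸ Ideal.span {((p * q : ℕ) : ZLam 5)}) ^ e = 0 := by
    obtain ⟨e, d, hd⟩ := hnil
    refine ⟨e, ?_⟩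
    rw [← Nat.cast_pow, hd, Nat.cast_mul (p * q) d, hA0, zero_mul]
  generalize Ideal.span {((p * q : ℕ) : ZLam 5)} = A at *
  set f := Ideal.Quotient.factor hle with hf
  have hker : ∀ x, f x = 0 → (p : ZLam 5 ⧸ A) ∣ x := by
    intro x hx
    obtain ⟨x, rfl⟩ := Ideal.Quotient.mk_surjective x
    rw [hf, Ideal.Quotient.factor_mk, Ideal.Quotient.eq_zero_iff_mem,
      Ideal.mem_span_singleton] at hx
    obtain ⟨y, rfl⟩ := hx
    exact ⟨Ideal.Quotient.mk A y, by simp⟩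
  have hpn : IsNilpotent (p : ZLam 5 ⧸ A) := hpow
  have hmemker : (Matrix.SpecialLinearGroup.map (n := Fin 2) f).ker ≤ levelImage A := by
    intro g hg
    obtain ⟨h1, h2, h3, h4⟩ := (mem_ker_map_iff f).1 hg
    exact mem_heckeOver_of_congruent_one (p := p) (mk_gold_sq A) exists_int_add_mul_mk_gold
      (by exact_mod_cast hpn) (by exact_mod_cast h)
      (by exact_mod_cast hker _ (by simp [h1])) (by exact_mod_cast hker _ h2)
      (by exact_mod_cast hker _ h3)
  have hkc : Nat.card (RingHom.ker f) = q ^ 2 := by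
    have h1 := card_eq_card_mul_card_ringHom_ker f (Ideal.Quotient.factor_surjective hle)
    rw [hAc, card_quotient_span_natCast hp, mul_pow] at h1
    exact (Nat.eq_of_mul_eq_mul_left (by positivity) h1).symm
  rw [card_heckeOver_eq_mul f _ (fun x hx => ?_) hmemker, hkc, hf, Ideal.Quotient.factor_mk,
    ← pow_mul]
  obtain ⟨y, rfl⟩ := hker x hx
  exact (Commute.all _ _).isNilpotent_mul_right hpn

theorem exists_int_mul_eq_one {B : Type*} [CommRing B] {m n : ℤ} (hn : (n : B) = 0)
    (h : IsCoprime m n) : ∃ c : ℤ, (m : B) * c = 1 := by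
  obtain ⟨u, v, huv⟩ := h
  refine ⟨u, ?_⟩
  have := congrArg (Int.cast : ℤ → B) huv
  push_cast at this
  rw [hn] at this
  linear_combination this

theorem card_levelImage_top : Nat.card (levelImage ⊤) = 1 := by
  have : Subsingleton (ZLam 5 ⧸ (⊤ : Ideal (ZLam 5))) := Ideal.Quotient.subsingleton_iff.2 rfl
  have : Subsingleton SL(2, ZLam 5 ⧸ (⊤ : Ideal (ZLam 5))) :=
    ⟨fun _ _ => sl_ext (Subsingleton.elim _ _) (Subsingleton.elim _ _) (Subsingleton.elim _ _)
      (Subsingleton.elim _ _)⟩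
  exact Nat.card_unique

theorem card_levelImage_three_pow (b : ℕ) :
    Nat.card (levelImage (Ideal.span {(3 : ZLam 5) ^ b})) = factorJ b := by
  cases b with
  | zero => rw [pow_zero, Ideal.span_singleton_one, card_levelImage_top, factorJ]
  | succ b =>
    have h0 := natCast_quotient_span (3 * 3 ^ b)
    have e : (3 : ZLam 5) ^ (b + 1) = ((3 * 3 ^ b : ℕ) : ZLam 5) := by push_cast; ring
    rw [e, card_levelImage_mul_of_nilpotent (by norm_num) (by positivity)
      ⟨b + 1, by rw [pow_succ']⟩]
    · have := card_levelImage_of_codeCheck (by norm_num) codeCheck_three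
      rw [this, factorJ, ← pow_mul]
      ring
    · obtain ⟨c, hc⟩ := exists_int_mul_eq_one (m := 4) (n := (3 * 3 ^ b : ℕ))
        (by exact_mod_cast h0) (by
          push_cast
          rw [← pow_succ']
          exact IsCoprime.pow_right (by norm_num))
      have h48 := fortyEight_mem_upperPart (mk_gold_sq _) (by exact_mod_cast hc)
      -- Since 4c = 1, 48c² = 3(4c)² = 3.
      have := (upperPart _).zsmul_mem h48 (c ^ 2)
      convert this using 1
      push_cast at hc ⊢
      rw [zsmul_eq_mul]
      push_cast
      linear_combination (-3 * (4 * (c : ZLam 5 ⧸ Ideal.span {((3 * 3 ^ b : ℕ) : ZLam 5)}) + 1)) * hc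

theorem card_levelImage_two_pow (a : ℕ) :
    Nat.card (levelImage (Ideal.span {(2 : ZLam 5) ^ a})) = factorI a := by
  match a with
  | 0 => rw [pow_zero, Ideal.span_singleton_one, card_levelImage_top, factorI]
  | 1 =>
    have := card_levelImage_of_codeCheck (by norm_num) codeCheck_two
    rw [pow_one, factorI]
    exact_mod_cast this
  -- Lifting starts at level 4: the step from 2 to 4 multiplies the order by 32 only, not by 2⁶.
  | a + 2 =>
    have h0 := natCast_quotient_span (4 * 2 ^ a)
    have e : (2 : ZLam 5) ^ (a + 2) = ((4 * 2 ^ a : ℕ) : ZLam 5) := by push_cast; ring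
    rw [e, card_levelImage_mul_of_nilpotent (by norm_num) (by positivity)
      ⟨a + 1, by rw [pow_succ']; exact mul_dvd_mul_left _ (pow_dvd_pow_of_dvd (by norm_num) a)⟩]
    · have := card_levelImage_of_codeCheck (by norm_num) codeCheck_four
      rw [this, factorI, ← pow_mul]
      ring
    · obtain ⟨c, hc⟩ := exists_int_mul_eq_one (m := 3) (n := (4 * 2 ^ a : ℕ))
        (by exact_mod_cast h0) (by
          push_cast
          exact IsCoprime.mul_right (by norm_num) (IsCoprime.pow_right (by norm_num)))
      refine four_mem_upperPart (mk_gold_sq _) exists_int_add_mul_mk_gold ⟨a + 2, ?_⟩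
        (by exact_mod_cast hc)
      rw [← h0]
      push_cast
      ring

end Lifting

/-! ### Levels of norm prime to 6 -/

section CoprimeToSix

/-- Lagrange in the additive group of the quotient; this supplies the rational integer needed by
`card_levelImage_mul`. -/
theorem intCast_idealNorm_mem (A : Ideal (ZLam 5)) : ((idealNorm A : ℤ) : ZLam 5) ∈ A := by
  rw [← Ideal.Quotient.eq_zero_iff_mem]
  have : (Nat.card (ZLam 5 ⧸ A) : ZLam 5 ⧸ A) = 0 := by
    have := card_nsmul_eq_zero' (G := ZLam 5 ⧸ A) (x := 1)
    simpa using this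
  simpa [idealNorm] using this

/-- Modulo A some integer multiple of 48 equals 1, so the translation by 1 is present; with that by
λ it generates all translations. -/
theorem levelImage_eq_top {A : Ideal (ZLam 5)} [Finite (ZLam 5 ⧸ A)]
    (hA : Nat.Coprime (idealNorm A) 6) : levelImage A = ⊤ := by
  have hn : ((idealNorm A : ℤ) : ZLam 5 ⧸ A) = 0 := by
    have := Ideal.Quotient.eq_zero_iff_mem.2 (intCast_idealNorm_mem A)
    simpa using this
  have hcop : IsCoprime (6 : ℤ) (idealNorm A : ℤ) := by
    exact_mod_cast Nat.isCoprime_iff_coprime.2 hA.symm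
  have h2 : IsCoprime (2 : ℤ) (idealNorm A : ℤ) := hcop.of_isCoprime_of_dvd_left ⟨3, rfl⟩
  have h3 : IsCoprime (3 : ℤ) (idealNorm A : ℤ) := hcop.of_isCoprime_of_dvd_left ⟨2, rfl⟩
  obtain ⟨c, hc⟩ := exists_int_mul_eq_one hn (m := 4) (h2.pow_left (m := 2))
  obtain ⟨d, hd⟩ := exists_int_mul_eq_one hn (m := 48) ((h2.pow_left (m := 4)).mul_left h3)
  have h1 : (1 : ZLam 5 ⧸ A) ∈ upperPart (levelImage A) := by
    have := (upperPart _).zsmul_mem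
      (fortyEight_mem_upperPart (mk_gold_sq A) (by exact_mod_cast hc)) d
    convert this using 1
    rw [zsmul_eq_mul, ← hd]
    push_cast
    ring
  refine eq_top_of_upperPart_eq_top (weyl_mem_heckeOver _) fun x => ?_
  obtain ⟨a, b, rfl⟩ := exists_int_add_mul_mk_gold x
  exact add_mem (by simpa using (upperPart _).zsmul_mem h1 a) (intCast_mul_mem_upperPart _ b)

theorem card_quotient_comap {B C : Type*} [CommRing B] [CommRing C] (f : B →+* C)
    (hf : Function.Surjective f) (I : Ideal C) :
    Nat.card (C ⧸ I) = Nat.card (B ⧸ I.comap f) := by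
  refine (Nat.card_congr (RingHom.quotientKerEquivOfSurjective
    (f := (Ideal.Quotient.mk I).comp f) (Ideal.Quotient.mk_surjective.comp hf)).toEquiv).symm.trans
    ?_
  rw [← RingHom.comap_ker, Ideal.mk_ker]

/-- Primes of a finite ring are maximal, and in a principal ideal ring containing (x) means dividing
it, so both products run over the same primes. -/
theorem finprod_maximalSpectrum_quotient (x : ZLam 5) [Finite (ZLam 5 ⧸ Ideal.span {x})]
    (F : ℕ → ℚ) :
    ∏ᶠ m : MaximalSpectrum (ZLam 5 ⧸ Ideal.span {x}),
      F (Nat.card ((ZLam 5 ⧸ Ideal.span {x}) ⧸ m.asIdeal)) =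
      ∏ᶠ P ∈ primeDivisors x, F (idealNorm P) := by
  have hdvd : ∀ P : Ideal (ZLam 5), P ∣ Ideal.span {x} ↔ Ideal.span {x} ≤ P := by
    intro P
    refine ⟨Ideal.le_of_dvd, fun h => ?_⟩
    obtain ⟨p, rfl⟩ := (IsPrincipalIdealRing.principal P).principal
    obtain ⟨y, rfl⟩ := Ideal.mem_span_singleton.1 (h (Ideal.mem_span_singleton_self x))
    exact ⟨Ideal.span {y}, (Ideal.span_singleton_mul_span_singleton p y).symm⟩
  rw [← finprod_set_coe_eq_finprod_mem (f := fun P => F (idealNorm P))]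
  set π := Ideal.Quotient.mk (Ideal.span {x}) with hπ
  have hsurj : Function.Surjective π := Ideal.Quotient.mk_surjective
  refine finprod_eq_of_bijective (fun m => ⟨m.asIdeal.comap π,
    (m.isMaximal.isPrime.comap π), (hdvd _).2 ?_⟩) ⟨?_, ?_⟩ ?_
  · exact (Ideal.mk_ker (I := Ideal.span {x})).ge.trans (Ideal.comap_mono bot_le)
  · intro m n h
    exact MaximalSpectrum.ext (Ideal.comap_injective_of_surjective π hsurj
      (congrArg Subtype.val h))
  · rintro ⟨P, hP, hPx⟩
    have hker : RingHom.ker π ≤ P := by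
      rw [hπ, Ideal.mk_ker]
      exact (hdvd P).1 hPx
    have hprime : (P.map π).IsPrime := Ideal.map_isPrime_of_surjective hsurj hker
    refine ⟨⟨P.map π, IsArtinianRing.isMaximal_of_isPrime _⟩, Subtype.ext ?_⟩
    change (P.map π).comap π = P
    rw [Ideal.comap_map_of_surjective _ hsurj, ← RingHom.ker_eq_comap_bot, sup_eq_left]
    exact hker
  · intro m
    congr 1
    exact card_quotient_comap π hsurj _

end CoprimeToSix

end HeckeIndex

/-- `relIndex` is 0 for infinite index, while the right side is nonzero, so the equality includes
finiteness of the index. -/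
theorem mainTheorem1 (a b : ℕ) (π : HeckeIndex.ZLam 5)
    (hπ : Nat.Coprime (HeckeIndex.elemNorm π) 6) :
    (((HeckeIndex.principalCongruence
        (Ideal.span {(2 : HeckeIndex.ZLam 5) ^ a * 3 ^ b * π})).relIndex
          (HeckeIndex.hecke 5) : ℕ) : ℚ) =
      (HeckeIndex.factorI a : ℚ) * (HeckeIndex.factorJ b : ℚ) *
        (HeckeIndex.elemNorm π : ℚ) ^ 3 *
        ∏ᶠ P ∈ HeckeIndex.primeDivisors π, (1 - ((HeckeIndex.idealNorm P : ℚ) ^ 2)⁻¹) := by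
  open HeckeIndex in
  -- An infinite quotient would have `Nat.card` equal to 0, which is not coprime to 6.
  have hfin : Finite (ZLam 5 ⧸ Ideal.span {π}) := by
    refine Nat.finite_of_card_ne_zero fun h => ?_
    rw [elemNorm, idealNorm, h] at hπ
    norm_num at hπ
  have hcop : IsCoprime (6 : ℤ) (elemNorm π : ℤ) := by
    exact_mod_cast Nat.isCoprime_iff_coprime.2 hπ.symm
  have h2 : IsCoprime (2 : ℤ) (elemNorm π : ℤ) := hcop.of_isCoprime_of_dvd_left ⟨3, rfl⟩
  have h3 : IsCoprime (3 : ℤ) (elemNorm π : ℤ) := hcop.of_isCoprime_of_dvd_left ⟨2, rfl⟩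
  have ha : (((2 ^ a : ℤ)) : ZLam 5) ∈ Ideal.span {(2 : ZLam 5) ^ a} := by
    simp
  have hb : (((3 ^ b : ℤ)) : ZLam 5) ∈ Ideal.span {(3 : ZLam 5) ^ b} := by
    simp
  have hab : (((2 ^ a * 3 ^ b : ℤ)) : ZLam 5) ∈
      Ideal.span {(2 : ZLam 5) ^ a} * Ideal.span {(3 : ZLam 5) ^ b} := by
    rw [Int.cast_mul]
    exact Ideal.mul_mem_mul ha hb
  rw [relIndex_principalCongruence, ← Ideal.span_singleton_mul_span_singleton,
    ← Ideal.span_singleton_mul_span_singleton,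
    card_levelImage_mul hab (intCast_idealNorm_mem (Ideal.span {π}))
      (h2.pow_left.mul_left h3.pow_left),
    card_levelImage_mul ha hb (IsCoprime.pow (by norm_num)), card_levelImage_two_pow,
    card_levelImage_three_pow, levelImage_eq_top hπ, Subgroup.card_top, Nat.cast_mul, Nat.cast_mul,
    card_sl_two_eq_prod,
    finprod_maximalSpectrum_quotient π (fun n => 1 - ((n : ℚ) ^ 2)⁻¹), ← mul_assoc]
  rfl
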